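/- Let $R$ be a complete, separated topological associative unital ring with a base of neighborhoods of zero formed by open right ideals. For a complete, separated topological abelian group $A$ with a base of neighborhoods of zero formed by open subgroups and a set $X$, let $A[[X]]$ be the group of all formal linear combinations $\sum_{x\in X}a_x x$ whose family of coefficients $a_x\in A$ converges to zero (every open subgroup of $A$ contains all but finitely many of the $a_x$). The functor $X\mapsto R[[X]]$ is a monad on the category of sets, with the point measures as unit and the opening of parentheses as multiplication; a left $R$-contramodule is an algebra $\pi_C\colon R[[C]]\to C$ over this monad. Every left $R$-contramodule is in particular a left $R$-module, the left $R$-contramodules form an abelian category, and "projective" means a projective object of this category. A right $R$-module $N$ is discrete if the annihilator of each of its elements is open in $R$. For a discrete right $R$-module $N$ and a left $R$-contramodule $C$, the contratensor product $N\odot_R C$ is the cokernel of the difference of the two maps $N\otimes_{\mathbb Z}R[[C]]\rightrightarrows N\otimes_{\mathbb Z}C$ given by $b\otimes\sum_c r_c c\mapsto b\otimes\pi_C(\sum_c r_c c)$ and $b\otimes\sum_c r_c c\mapsto\sum_c br_c\otimes c$ (a finite sum). A left $R$-contramodule $F$ is flat if the functor $N\mapsto N\odot_R F$ from discrete right $R$-modules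 to abelian groups is exact. Let $H\subset R$ be a closed two-sided ideal that is (a) strongly closed: the quotient $R/H$ is complete in the quotient topology and, for every set $X$, the induced map $R[[X]]\to(R/H)[[X]]$ is surjective; and (b) topologically left T-nilpotent: for every sequence $a_1,a_2,a_3,\dots$ of elements of $H$, the sequence $a_1,\ a_1a_2,\ a_1a_2a_3,\dots$ converges to zero in $R$. For a left $R$-contramodule $C$, let $H\rightthreetimes C\subset C$ be the image of $H[[C]]\subset R[[C]]$ under $\pi_C$. Then the quotient $C/(H\rightthreetimes C)$ has a unique left contramodule structure over the topological ring $R/H$ for which the projection $C\to C/(H\rightthreetimes C)$ is compatible with the contraactions along $R\to R/H$. Theorem. Let $F$ be a flat left $R$-contramodule. Then the left $R$-contramodule $F$ is projective if and only if the left $R/H$-contramodule $F/(H\rightthreetimes F)$ is projective. -/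

import Mathlib

universe u

namespace ContramoduleTheory

open Filter Topology TensorProduct

/-! ### Topological rings with a base of open right ideals -/

/-- A complete, separated topological ring in which open right ideals form a base of
neighborhoods of zero. Right ideals are the `Rᵐᵒᵖ`-submodules of `R`, and completeness refers to
the canonical uniform structure of the additive topological group of `R`. -/
class IsContramoduleRing (R : Type*) [Ring R] [TopologicalSpace R] : Prop extends
    IsTopologicalRing R, T2Space R, IsLinearTopology Rᵐᵒᵖ R where
  complete : @CompleteSpace R (IsTopologicalAddGroup.rightUniformSpace R)

section Convergence

theorem right_ideal_mul_mem {R : Type*} [Ring R] (I : Submodule Rᵐᵒᵖ R) {a : R} (ha : a ∈ I) (b : R) : a * b ∈ I := by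
  simpa using I.smul_mem (MulOpposite.op b) ha

theorem tsum_mem_of_isClosed {R : Type*} [Ring R] [TopologicalSpace R] {ι : Type*} {f : ι → R}
    {H : AddSubgroup R}
    (hH : IsClosed (H : Set R)) (hf : ∀ i, f i ∈ H) : ∑' i, f i ∈ H := by
  by_cases hs : Summable f
  · exact hH.mem_of_tendsto hs.hasSum (Eventually.of_forall fun s => sum_mem fun i _ => hf i)
  · rw [tsum_eq_zero_of_not_summable hs]; exact H.zero_mem

variable {R : Type*} [Ring R] [TopologicalSpace R] [IsContramoduleRing R]

theorem exists_open_right_ideal {U : Set R} (hU : U ∈ 𝓝 (0 : R)) :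
    ∃ I : Submodule Rᵐᵒᵖ R, IsOpen (I : Set R) ∧ (I : Set R) ⊆ U := by
  obtain ⟨I, hI, hIU⟩ := (IsLinearTopology.hasBasis_open_submodule Rᵐᵒᵖ).mem_iff.1 hU
  exact ⟨I, hI, hIU⟩

instance : NonarchimedeanRing R where
  is_nonarchimedean U hU := by
    obtain ⟨I, hI, hIU⟩ := exists_open_right_ideal hU
    exact ⟨⟨I.toAddSubgroup, hI⟩, hIU⟩

theorem summable_of_tendsto_zero {ι : Type*} {f : ι → R} (hf : Tendsto f cofinite (𝓝 0)) :
    Summable f := by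
  let : UniformSpace R := IsTopologicalAddGroup.rightUniformSpace R
  have : IsUniformAddGroup R := isUniformAddGroup_of_addCommGroup
  have : CompleteSpace R := IsContramoduleRing.complete
  exact NonarchimedeanAddGroup.summable_of_tendsto_cofinite_zero hf

theorem tendsto_zero_iff {ι : Type*} {f : ι → R} :
    Tendsto f cofinite (𝓝 0) ↔
      ∀ I : Submodule Rᵐᵒᵖ R, IsOpen (I : Set R) → {i | f i ∉ I}.Finite := by
  rw [(IsLinearTopology.hasBasis_open_submodule Rᵐᵒᵖ).tendsto_right_iff]
  rfl

theorem tendsto_mul_right_zero {ι : Type*} {f : ι → R} (hf : Tendsto f cofinite (𝓝 0))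
    (g : ι → R) : Tendsto (fun i => f i * g i) cofinite (𝓝 0) := by
  rw [tendsto_zero_iff] at hf ⊢
  exact fun I hI => (hf I hI).subset fun i hi h => hi (right_ideal_mul_mem I h _)

theorem exists_mul_mem (I : Submodule Rᵐᵒᵖ R) (hI : IsOpen (I : Set R)) (r : R) :
    ∃ J : Submodule Rᵐᵒᵖ R, IsOpen (J : Set R) ∧ ∀ a ∈ J, r * a ∈ I := by
  have : (fun a => r * a) ⁻¹' (I : Set R) ∈ 𝓝 (0 : R) :=
    (continuous_const_mul r).continuousAt.preimage_mem_nhds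
      (by simpa using hI.mem_nhds (by simp))
  obtain ⟨J, hJ, h⟩ := exists_open_right_ideal this
  exact ⟨J, hJ, fun a ha => h ha⟩

theorem tendsto_uncurry_zero {Y X : Type*} {a : Y → R} (ha : Tendsto a cofinite (𝓝 0))
    {b : Y → X → R} (hb : ∀ y, Tendsto (b y) cofinite (𝓝 0)) :
    Tendsto (fun p : Y × X => a p.1 * b p.1 p.2) cofinite (𝓝 0) := by
  rw [tendsto_zero_iff] at ha ⊢
  intro I hI
  have key : ∀ y, {x | a y * b y x ∉ I}.Finite := by
    intro y
    obtain ⟨J, hJ, h⟩ := exists_mul_mem I hI (a y)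
    exact (tendsto_zero_iff.1 (hb y) J hJ).subset fun x hx hxJ => hx (h _ hxJ)
  refine ((ha I hI).biUnion fun y _ => (key y).image (Prod.mk y)).subset ?_
  rintro ⟨y, x⟩ h
  simp only [Set.mem_iUnion]
  exact ⟨y, fun hy => h (right_ideal_mul_mem I hy _), x, h, rfl⟩

theorem tendsto_bind_zero {Y X : Type*} {a : Y → R} (ha : Tendsto a cofinite (𝓝 0))
    {b : Y → X → R} (hb : ∀ y, Tendsto (b y) cofinite (𝓝 0)) :
    Tendsto (fun x => ∑' y, a y * b y x) cofinite (𝓝 0) := by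
  have h2 := tendsto_uncurry_zero ha hb
  rw [tendsto_zero_iff] at h2 ⊢
  intro I hI
  refine ((h2 I hI).image Prod.snd).subset fun x hx => ?_
  by_contra hcon
  refine hx (tsum_mem_of_isClosed (H := I.toAddSubgroup)
    (AddSubgroup.isClosed_of_isOpen _ hI) fun y => ?_)
  by_contra hy
  exact hcon ⟨(y, x), hy, rfl⟩

end Convergence

/-! ### Convergent formal linear combinations -/

/-- The group `A[[X]]` of all formal linear combinations `∑ aₓ x` of elements of `X` whose
coefficients form an `X`-indexed family converging to zero in `A`, that is, every neighborhood of
zero contains all but finitely many of them. -/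
def formalSums (A X : Type*) [AddCommGroup A] [TopologicalSpace A] [IsTopologicalAddGroup A] :
    AddSubgroup (X → A) where
  carrier := {a | Tendsto a cofinite (𝓝 0)}
  zero_mem' := tendsto_const_nhds
  add_mem' ha hb := by simpa using! Tendsto.add ha hb
  neg_mem' ha := by simpa using! Tendsto.neg ha

/-- `A[[X]]` as a type. -/
abbrev FormalSum (A X : Type*) [AddCommGroup A] [TopologicalSpace A] [IsTopologicalAddGroup A] :
    Type _ :=
  formalSums A X

namespace FormalSum

section Monad

variable {R : Type*} [Ring R] [TopologicalSpace R] [IsContramoduleRing R]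
variable {X Y Z : Type*}

@[ext]
theorem ext {a b : FormalSum R X} (h : ∀ x, a.1 x = b.1 x) : a = b := Subtype.ext (funext h)

/-- The functoriality `R[[f]] : R[[X]] → R[[Y]]`, which takes `∑ aₓ x` to the formal linear
combination with the coefficient `∑_{f(x) = y} aₓ` at `y`. -/
noncomputable def coeffMap (f : X → Y) (a : X → R) (y : Y) : R := ∑' x : {x // f x = y}, a x

open Classical in
/-- The monad unit `X → R[[X]]` (the point measures). -/
noncomputable def single (x : X) : FormalSum R X :=
  ⟨Pi.single x 1, tendsto_zero_iff.2 fun I _ => (Set.finite_singleton x).subset fun y hy => by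
    by_contra h
    exact hy (by simp [Pi.single_eq_of_ne h])⟩

/-- The substitution of a formal linear combination `b y ∈ R[[X]]` for every formal variable `y` in
`∑ a_y y ∈ R[[Y]]`, with opening of the parentheses: the coefficient at `x` of the result is
`∑_y a_y b_{y,x}`. -/
noncomputable def bind (a : FormalSum R Y) (b : Y → FormalSum R X) : FormalSum R X :=
  ⟨fun x => ∑' y, a.1 y * (b y).1 x, tendsto_bind_zero a.2 fun y => (b y).2⟩

theorem coeffMap_eq_bind (f : X → Y) (a : FormalSum R X) :
    coeffMap f a.1 = (bind a fun x => single (f x)).1 := by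
  classical
  funext y
  change ∑' x : {x | f x = y}, a.1 x = ∑' x, a.1 x * (single (R := R) (f x)).1 y
  rw [tsum_subtype {x | f x = y} a.1]
  refine tsum_congr fun x => ?_
  by_cases h : f x = y
  · subst h
    simp [single]
  · simp [single, h, Ne.symm h]

/-- The map `R[[f]] : R[[X]] → R[[Y]]` induced by a map of sets `f : X → Y`. -/
noncomputable def map (f : X → Y) (a : FormalSum R X) : FormalSum R Y :=
  ⟨coeffMap f a.1, by rw [coeffMap_eq_bind]; exact (bind a fun x => single (f x)).2⟩

/-- The monad multiplication `R[[R[[X]]]] → R[[X]]` (opening of parentheses): the coefficient at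
`x` of the image of `∑_y r_y y` is `∑_y r_y y_x`, where `y` ranges over `R[[X]]`. -/
noncomputable def join (r : FormalSum R (FormalSum R X)) : FormalSum R X :=
  bind r id

theorem map_eq_bind (f : X → Y) (a : FormalSum R X) : map f a = bind a fun x => single (f x) :=
  Subtype.ext (coeffMap_eq_bind f a)

theorem summable_bind (a : FormalSum R Y) (b : Y → R) : Summable fun y => a.1 y * b y :=
  summable_of_tendsto_zero (tendsto_mul_right_zero a.2 b)

theorem single_bind (y : Y) (b : Y → FormalSum R X) : bind (single y) b = b y := by
  classical
  ext x
  change ∑' z, (single (R := R) y).1 z * (b z).1 x = _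
  rw [tsum_eq_single y]
  · simp [single]
  · intro z hz
    simp [single, Pi.single_eq_of_ne hz]

theorem bind_single (a : FormalSum R X) : bind a single = a := by
  classical
  ext x
  change ∑' z, a.1 z * (single (R := R) z).1 x = _
  rw [tsum_eq_single x]
  · simp [single]
  · intro z hz
    simp [single, Pi.single_eq_of_ne hz.symm]

theorem bind_assoc (a : FormalSum R Z) (b : Z → FormalSum R Y) (c : Y → FormalSum R X) :
    bind (bind a b) c = bind a fun z => bind (b z) c := by
  ext x
  change ∑' y, (∑' z, a.1 z * (b z).1 y) * (c y).1 x =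
    ∑' z, a.1 z * ∑' y, (b z).1 y * (c y).1 x
  have h1 : ∀ y, (∑' z, a.1 z * (b z).1 y) * (c y).1 x =
      ∑' z, a.1 z * (b z).1 y * (c y).1 x := fun y =>
    ((summable_bind a fun z => (b z).1 y).tsum_mul_right _).symm
  have h2 : ∀ z, a.1 z * ∑' y, (b z).1 y * (c y).1 x =
      ∑' y, a.1 z * (b z).1 y * (c y).1 x := fun z => by
    rw [← (summable_bind (b z) fun y => (c y).1 x).tsum_mul_left]
    simp [mul_assoc]
  simp_rw [h1, h2]
  let : UniformSpace R := IsTopologicalAddGroup.rightUniformSpace R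
  have : IsUniformAddGroup R := isUniformAddGroup_of_addCommGroup
  have : CompleteSpace R := IsContramoduleRing.complete
  refine Summable.tsum_comm (f := fun z y => a.1 z * (b z).1 y * (c y).1 x) ?_
  exact summable_of_tendsto_zero (tendsto_mul_right_zero
    (tendsto_uncurry_zero a.2 fun z => (b z).2) fun p => (c p.2).1 x)

theorem bind_add (a a' : FormalSum R Y) (b : Y → FormalSum R X) :
    bind (a + a') b = bind a b + bind a' b := by
  ext x
  change ∑' y, (a.1 y + a'.1 y) * (b y).1 x = _
  simp_rw [add_mul]
  exact (summable_bind a _).tsum_add (summable_bind a' _)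

theorem bind_sub_right (a : FormalSum R Y) (b b' : Y → FormalSum R X) :
    bind a (fun y => b y - b' y) = bind a b - bind a b' := by
  ext x
  change ∑' y, a.1 y * ((b y).1 x - (b' y).1 x) = _
  simp_rw [mul_sub]
  exact (summable_bind a _).tsum_sub (summable_bind a _)

/-- `bind` as an additive homomorphism in the first argument. -/
noncomputable def bindHom (b : Y → FormalSum R X) : FormalSum R Y →+ FormalSum R X :=
  AddMonoidHom.mk' (fun a => bind a b) fun a a' => bind_add a a' b

theorem bind_zero (b : Y → FormalSum R X) : bind (0 : FormalSum R Y) b = 0 :=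
  (bindHom b).map_zero

theorem bind_neg (a : FormalSum R Y) (b : Y → FormalSum R X) : bind (-a) b = -bind a b :=
  (bindHom b).map_neg a

theorem bind_sub (a a' : FormalSum R Y) (b : Y → FormalSum R X) :
    bind (a - a') b = bind a b - bind a' b :=
  (bindHom b).map_sub a a'

theorem bind_nsmul (n : ℕ) (a : FormalSum R Y) (b : Y → FormalSum R X) :
    bind (n • a) b = n • bind a b :=
  (bindHom b).map_nsmul n a

theorem bind_zsmul (n : ℤ) (a : FormalSum R Y) (b : Y → FormalSum R X) :
    bind (n • a) b = n • bind a b :=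
  (bindHom b).map_zsmul n a

theorem map_single (f : X → Y) (x : X) : map f (single x : FormalSum R X) = single (f x) := by
  rw [map_eq_bind, single_bind]

theorem map_map (f : X → Y) (g : Y → Z) (a : FormalSum R X) :
    map g (map f a) = map (fun x => g (f x)) a := by
  simp only [map_eq_bind, bind_assoc, single_bind]

theorem map_id (a : FormalSum R X) : map (fun x => x) a = a := by
  rw [map_eq_bind, bind_single]

theorem map_bind (a : FormalSum R Z) (b : Z → FormalSum R X) (f : X → Y) :
    map f (bind a b) = bind a fun z => map f (b z) := by
  simp only [map_eq_bind, bind_assoc]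

theorem bind_map (a : FormalSum R Z) (f : Z → Y) (b : Y → FormalSum R X) :
    bind (map f a) b = bind a fun z => b (f z) := by
  simp only [map_eq_bind, bind_assoc, single_bind]

theorem join_map (a : FormalSum R Y) (b : Y → FormalSum R X) : join (map b a) = bind a b :=
  bind_map a b id

theorem map_sub (f : X → Y) (a b : FormalSum R X) : map f (a - b) = map f a - map f b := by
  simp only [map_eq_bind, bind_sub]

end Monad

end FormalSum

/-! ### Left contramodules -/

/-- A left `R`-contramodule: an algebra over the monad `X ↦ R[[X]]` on the category of sets, that
is, a set `C` with a contraaction map `R[[C]] → C` that satisfies the contraunitality and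
contraassociativity equations. -/
structure LeftContramodule (R : Type u) [Ring R] [TopologicalSpace R] [IsContramoduleRing R] where
  /-- The underlying set. -/
  carrier : Type u
  /-- The left contraaction map. -/
  act : FormalSum R carrier → carrier
  act_single : ∀ c, act (FormalSum.single c) = c
  act_join : ∀ r : FormalSum R (FormalSum R carrier),
    act (FormalSum.join r) = act (FormalSum.map act r)

namespace LeftContramodule

open FormalSum

variable {R : Type u} [Ring R] [TopologicalSpace R] [IsContramoduleRing R]

instance : CoeSort (LeftContramodule R) (Type u) := ⟨carrier⟩

/-- A morphism of left contramodules: a map that commutes with the contraactions. -/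
@[ext]
structure Hom (C D : LeftContramodule R) where
  /-- The underlying map. -/
  toFun : C → D
  map_act : ∀ r : FormalSum R C, toFun (C.act r) = D.act (FormalSum.map toFun r)

/-- The category of left `R`-contramodules. -/
instance : CategoryTheory.Category (LeftContramodule R) where
  Hom := Hom
  id C := ⟨fun c => c, fun r => by rw [FormalSum.map_id]⟩
  comp f g := ⟨fun c => g.toFun (f.toFun c), fun r => by
    rw [f.map_act, g.map_act, FormalSum.map_map]⟩

variable (C : LeftContramodule R)

/-! The additive group of a contramodule, with `a + b = act (1·a + 1·b)`. -/

instance : Zero C := ⟨C.act 0⟩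
noncomputable instance : Add C := ⟨fun a b => C.act (single a + single b)⟩
noncomputable instance : Neg C := ⟨fun a => C.act (-single a)⟩
noncomputable instance : Sub C := ⟨fun a b => C.act (single a - single b)⟩
noncomputable instance : SMul ℕ C := ⟨fun n a => C.act (n • single a)⟩
noncomputable instance : SMul ℤ C := ⟨fun n a => C.act (n • single a)⟩

variable {C}

theorem act_bind {Y : Type*} (a : FormalSum R Y) (b : Y → FormalSum R C) :
    C.act (bind a b) = C.act (FormalSum.map (fun y => C.act (b y)) a) := by
  rw [← join_map, C.act_join, FormalSum.map_map]

theorem act_add (a b : FormalSum R C) : C.act (a + b) = C.act a + C.act b := by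
  have h1 : FormalSum.join (single a + single b) = a + b := by
    simp only [FormalSum.join, bind_add, single_bind, id]
  have h2 := C.act_join (single a + single b)
  rw [h1, FormalSum.map_eq_bind, bind_add, single_bind, single_bind] at h2
  exact h2

theorem act_hom_aux (f : ∀ X : Type u, FormalSum R X → FormalSum R X)
    (hf : ∀ (X Y : Type u) (b : X → FormalSum R Y) (a), bind (f X a) b = f Y (bind a b))
    (a : FormalSum R C) : C.act (f C a) = C.act (f C (single (C.act a))) := by
  have h1 : FormalSum.join (f _ (single a)) = f C a := by
    rw [FormalSum.join, hf, single_bind, id]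
  have h2 := C.act_join (f _ (single a))
  rw [h1, map_eq_bind, hf, single_bind] at h2
  exact h2

theorem act_neg (a : FormalSum R C) : C.act (-a) = -C.act a :=
  act_hom_aux (fun _ a => -a) (fun _ _ b a => bind_neg a b) a

theorem act_sub (a b : FormalSum R C) : C.act (a - b) = C.act a - C.act b := by
  have h1 : FormalSum.join (single a - single b) = a - b := by
    rw [FormalSum.join, bind_sub, single_bind, single_bind, id, id]
  have h2 := C.act_join (single a - single b)
  rw [h1, FormalSum.map_sub, FormalSum.map_single, FormalSum.map_single] at h2
  exact h2

theorem act_surjective : Function.Surjective C.act := fun c => ⟨single c, C.act_single c⟩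

variable (C)

/-- The underlying additive group of a left contramodule. -/
noncomputable instance : AddCommGroup C :=
  Function.Surjective.addCommGroup C.act act_surjective rfl act_add act_neg act_sub
    (fun a n => act_hom_aux (fun _ a => n • a) (fun _ _ b a => bind_nsmul n a b) a)
    (fun a n => act_hom_aux (fun _ a => n • a) (fun _ _ b a => bind_zsmul n a b) a)

/-- The contraaction as an additive homomorphism. -/
noncomputable def actHom : FormalSum R C →+ C := AddMonoidHom.mk' C.act act_add

/-- For a (closed) subgroup `A` of `R`, the subgroup of `C` which is the image of
`A[[C]] ⊆ R[[C]]` under the contraaction map. -/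
def contraSpan (A : AddSubgroup R) : AddSubgroup C where
  carrier := {c | ∃ r : FormalSum R C, (∀ x, r.1 x ∈ A) ∧ C.act r = c}
  zero_mem' := ⟨0, fun _ => A.zero_mem, rfl⟩
  add_mem' := by
    rintro _ _ ⟨r, hr, rfl⟩ ⟨s, hs, rfl⟩
    exact ⟨r + s, fun x => A.add_mem (hr x) (hs x), act_add r s⟩
  neg_mem' := by
    rintro _ ⟨r, hr, rfl⟩
    exact ⟨-r, fun x => A.neg_mem (hr x), act_neg r⟩

end LeftContramodule

/-! ### Discrete right modules, contratensor product, flatness -/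

/-- A right `R`-module `N` is discrete if the annihilator of every element is open in `R`. -/
class IsDiscreteRightModule (R : Type*) [Ring R] [TopologicalSpace R] (N : Type*) [AddCommGroup N]
    [Module Rᵐᵒᵖ N] : Prop where
  isOpen_annihilator : ∀ b : N, IsOpen {r : R | MulOpposite.op r • b = 0}

section Contratensor

variable {R : Type u} [Ring R] [TopologicalSpace R] [IsContramoduleRing R]

theorem finite_support_smul {N : Type*} [AddCommGroup N] [Module Rᵐᵒᵖ N]
    [IsDiscreteRightModule R N] {X : Type*} (b : N) (r : FormalSum R X) :
    {x | MulOpposite.op (r.1 x) • b ≠ 0}.Finite := by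
  have h : {r : R | MulOpposite.op r • b = 0} ∈ 𝓝 (0 : R) :=
    (IsDiscreteRightModule.isOpen_annihilator b).mem_nhds (by simp)
  exact r.2 h

variable (N : Type u) [AddCommGroup N] [Module Rᵐᵒᵖ N] (C : LeftContramodule R)

/-- The image of the difference of the two maps `N ⊗ R[[C]] ⇉ N ⊗ C` (tensor products over `ℤ`),
`b ⊗ ∑ r_c c ↦ b ⊗ act (∑ r_c c)` and `b ⊗ ∑ r_c c ↦ ∑ (b r_c) ⊗ c`, where the last sum is finite
if `N` is discrete. -/
noncomputable def contratensorRelations : AddSubgroup (N ⊗[ℤ] C) :=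
  AddSubgroup.closure (Set.range fun p : N × FormalSum R C =>
    p.1 ⊗ₜ[ℤ] C.act p.2 - ∑ᶠ c : C, (MulOpposite.op (p.2.1 c) • p.1) ⊗ₜ[ℤ] c)

/-- The contratensor product `N ⊙ C` of a discrete right module `N` and a left contramodule `C`:
the cokernel of the difference of the two maps `N ⊗ R[[C]] ⇉ N ⊗ C`. -/
abbrev Contratensor : Type u := (N ⊗[ℤ] C) ⧸ contratensorRelations N C

variable {N} {N' : Type u} [AddCommGroup N'] [Module Rᵐᵒᵖ N']

/-- The homomorphism `f ⊙ C : N ⊙ C → N' ⊙ C` induced by a homomorphism of discrete right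
modules `f : N → N'`. -/
noncomputable def contratensorMap [IsDiscreteRightModule R N] (f : N →ₗ[Rᵐᵒᵖ] N') :
    Contratensor N C →+ Contratensor N' C :=
  QuotientAddGroup.map _ _ (TensorProduct.map f.toAddMonoidHom.toIntLinearMap
    LinearMap.id).toAddMonoidHom (by
      rw [contratensorRelations, AddSubgroup.closure_le]
      rintro _ ⟨⟨b, r⟩, rfl⟩
      refine AddSubgroup.subset_closure ⟨(f b, r), ?_⟩
      have hfin : (Function.support fun c : C =>
          (MulOpposite.op (r.1 c) • b) ⊗ₜ[ℤ] c).Finite :=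
        (finite_support_smul b r).subset fun c hc h => hc (by simp [h])
      simp only [map_sub, AddMonoidHom.map_finsum _ hfin, LinearMap.toAddMonoidHom_coe,
        TensorProduct.map_tmul]
      simp)

/-- A left contramodule `F` is flat if the functor `- ⊙ F` from discrete right modules to abelian
groups is exact: it takes short exact sequences to short exact sequences. -/
def LeftContramodule.IsFlat (F : LeftContramodule R) : Prop :=
  ∀ (L M N : Type u) [AddCommGroup L] [AddCommGroup M] [AddCommGroup N]
    [Module Rᵐᵒᵖ L] [Module Rᵐᵒᵖ M] [Module Rᵐᵒᵖ N]
    [IsDiscreteRightModule R L] [IsDiscreteRightModule R M] [IsDiscreteRightModule R N]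
    (f : L →ₗ[Rᵐᵒᵖ] M) (g : M →ₗ[Rᵐᵒᵖ] N),
    Function.Injective f → Function.Exact f g → Function.Surjective g →
      Function.Injective (contratensorMap F f) ∧
      Function.Exact (contratensorMap F f) (contratensorMap F g) ∧
      Function.Surjective (contratensorMap F g)

end Contratensor

/-! ### Ideals and reductions -/

section Ideals

variable {R : Type u} [Ring R] [TopologicalSpace R]

/-- An ideal `H` is topologically left T-nilpotent if for any sequence `a₁, a₂, a₃, …` of elements
of `H` the sequence of the products `a₁, a₁a₂, a₁a₂a₃, …` converges to zero. -/
def IsTopologicallyLeftTNilpotent (H : Ideal R) : Prop :=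
  ∀ a : ℕ → R, (∀ n, a n ∈ H) →
    Tendsto (fun n => ((List.range (n + 1)).map a).prod) atTop (𝓝 0)

/-- A closed ideal `H` is strongly closed if the quotient group `R ⧸ H` is complete in the quotient
topology and, for every set `X`, the map `R[[X]] → (R ⧸ H)[[X]]` induced by the projection is
surjective. -/
class IsStronglyClosed [IsTopologicalAddGroup R] (H : Ideal R) : Prop where
  isClosed : IsClosed (H : Set R)
  complete : @CompleteSpace (R ⧸ H) (IsTopologicalAddGroup.rightUniformSpace (R ⧸ H))
  exists_lift : ∀ (X : Type u) (s : FormalSum (R ⧸ H) X),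
    ∃ r : FormalSum R X, ∀ x, (Submodule.Quotient.mk (r.1 x) : R ⧸ H) = s.1 x

theorem continuous_idealQuotient_mk (H : Ideal R) [H.IsTwoSided] :
    Continuous (Ideal.Quotient.mk H) := H.continuous_mkQ

variable [IsContramoduleRing R] (H : Ideal R) [H.IsTwoSided] [IsStronglyClosed H]

/-- The quotient of `R` by a strongly closed two-sided ideal, with the quotient topology, is again
complete and separated with a base of open right ideals. -/
instance : IsContramoduleRing (R ⧸ H) := by
  have hq : IsOpenQuotientMap (Ideal.Quotient.mk H) := H.isOpenQuotientMap_mkQ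
  have hring : IsTopologicalRing (R ⧸ H) :=
    { Submodule.topologicalAddGroup_quotient H with
      continuous_mul := by
        rw [← (hq.prodMap hq).continuous_comp_iff]
        exact hq.continuous.comp continuous_mul }
  have hcl : IsClosed (H : Set R) := IsStronglyClosed.isClosed
  have hT3 : T3Space (R ⧸ H) := Submodule.t3_quotient_of_isClosed H
  have hlin : IsLinearTopology (R ⧸ H)ᵐᵒᵖ (R ⧸ H) := by
    rw [isLinearTopology_iff_hasBasis_open_submodule]
    refine ⟨fun U => ⟨fun hU => ?_, ?_⟩⟩
    · have h0 : Ideal.Quotient.mk H ⁻¹' U ∈ 𝓝 (0 : R) :=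
        hq.continuous.continuousAt.preimage_mem_nhds (by simpa using hU)
      obtain ⟨I, hI, hIU⟩ := exists_open_right_ideal h0
      let J : Submodule (R ⧸ H)ᵐᵒᵖ (R ⧸ H) :=
        { I.toAddSubgroup.map (Ideal.Quotient.mk H).toAddMonoidHom with
          smul_mem' := by
            rintro c _ ⟨x, hx, rfl⟩
            obtain ⟨r, hr⟩ := Ideal.Quotient.mk_surjective c.unop
            refine ⟨x * r, right_ideal_mul_mem I hx r, ?_⟩
            rw [← MulOpposite.op_unop c, ← hr]
            exact map_mul (Ideal.Quotient.mk H) x r }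
      refine ⟨J, hq.isOpenMap _ hI, ?_⟩
      rintro _ ⟨x, hx, rfl⟩
      exact hIU hx
    · rintro ⟨J, hJ, hJU⟩
      exact Filter.mem_of_superset (hJ.mem_nhds J.zero_mem) hJU
  exact { hring, hlin, (inferInstance : T2Space (R ⧸ H)) with
          complete := IsStronglyClosed.complete }

/-- The map `R[[X]] → (R ⧸ H)[[X]]` induced by the projection `R → R ⧸ H`. -/
noncomputable def coeffQuotient {X : Type*} (r : FormalSum R X) : FormalSum (R ⧸ H) X :=
  ⟨fun x => Ideal.Quotient.mk H (r.1 x), by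
    have h := (continuous_idealQuotient_mk H).tendsto 0
    rw [map_zero] at h
    exact h.comp r.2⟩

theorem coeffQuotient_surjective {X : Type u} :
    Function.Surjective (coeffQuotient H : FormalSum R X → FormalSum (R ⧸ H) X) := by
  intro s
  obtain ⟨r, hr⟩ := IsStronglyClosed.exists_lift X s
  exact ⟨r, FormalSum.ext hr⟩

open FormalSum

theorem coeffQuotient_single {X : Type*} (x : X) :
    coeffQuotient H (single x) = single x := by
  classical
  ext y
  change Ideal.Quotient.mk H ((single (R := R) x).1 y) = _
  by_cases h : y = x
  · subst h; simp [single]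
  · simp [single, Pi.single_eq_of_ne h]

theorem coeffQuotient_bind {X Y : Type*} (a : FormalSum R Y) (b : Y → FormalSum R X) :
    coeffQuotient H (bind a b) = bind (coeffQuotient H a) fun y => coeffQuotient H (b y) := by
  ext x
  change Ideal.Quotient.mk H (∑' y, a.1 y * (b y).1 x) =
    ∑' y, Ideal.Quotient.mk H (a.1 y) * Ideal.Quotient.mk H ((b y).1 x)
  rw [(summable_bind a fun y => (b y).1 x).map_tsum (Ideal.Quotient.mk H)
    (continuous_idealQuotient_mk H)]
  simp

theorem coeffQuotient_map {X Y : Type*} (f : X → Y) (a : FormalSum R X) :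
    coeffQuotient H (FormalSum.map f a) = FormalSum.map f (coeffQuotient H a) := by
  simp only [FormalSum.map_eq_bind, coeffQuotient_bind, coeffQuotient_single]

theorem map_surjective {X Y : Type*} {f : X → Y} (hf : Function.Surjective f) :
    Function.Surjective (FormalSum.map f : FormalSum R X → FormalSum R Y) := fun a =>
  ⟨FormalSum.map (Function.surjInv hf) a, by
    rw [FormalSum.map_map]; simp only [Function.surjInv_eq hf]; exact FormalSum.map_id a⟩

variable (C : LeftContramodule R)

namespace LeftContramodule

/-- The subgroup `H ⋌ C` of `C`: the image of `H[[C]]` under the contraaction map. -/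
def idealContraSpan : AddSubgroup C := C.contraSpan H.toAddSubgroup

/-- The underlying group `C ⧸ (H ⋌ C)` of the reduction of `C` modulo `H`. -/
abbrev ReductionCarrier : Type u := C ⧸ C.idealContraSpan H

/-- The projection `C → C ⧸ (H ⋌ C)`. -/
noncomputable def toReduction : C →+ C.ReductionCarrier H := QuotientAddGroup.mk' _

theorem toReduction_surjective : Function.Surjective (C.toReduction H) :=
  QuotientAddGroup.mk'_surjective _

theorem act_bind_mem_left {Y : Type*} (a : FormalSum R Y) (b : Y → FormalSum R C)
    (ha : ∀ y, a.1 y ∈ H) : C.act (bind a b) ∈ C.idealContraSpan H :=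
  ⟨bind a b, fun _ => tsum_mem_of_isClosed (H := H.toAddSubgroup) IsStronglyClosed.isClosed
    fun y => H.mul_mem_right _ (ha y), rfl⟩

theorem act_bind_mem_right {Y : Type*} (a : FormalSum R Y) (b : Y → FormalSum R C)
    (hb : ∀ y x, (b y).1 x ∈ H) : C.act (bind a b) ∈ C.idealContraSpan H :=
  ⟨bind a b, fun x => tsum_mem_of_isClosed (H := H.toAddSubgroup) IsStronglyClosed.isClosed
    fun y => H.mul_mem_left _ (hb y x), rfl⟩

/-- The map `R[[C]] → (R ⧸ H)[[C ⧸ (H ⋌ C)]]` induced by the two projections. -/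
noncomputable def pushSum (r : FormalSum R C) : FormalSum (R ⧸ H) (C.ReductionCarrier H) :=
  coeffQuotient H (FormalSum.map (C.toReduction H) r)

theorem pushSum_surjective : Function.Surjective (C.pushSum H) :=
  (coeffQuotient_surjective H).comp (map_surjective (C.toReduction_surjective H))

/-- The class of `act r` modulo `H ⋌ C` depends only on the image of `r` in
`(R ⧸ H)[[C ⧸ (H ⋌ C)]]`. -/
theorem toReduction_act_eq {r r' : FormalSum R C} (h : C.pushSum H r = C.pushSum H r') :
    C.toReduction H (C.act r) = C.toReduction H (C.act r') := by
  let q := C.toReduction H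
  let σ : C.ReductionCarrier H → C := Function.surjInv (C.toReduction_surjective H)
  have hσ : ∀ x, q (σ x) = x := Function.surjInv_eq (C.toReduction_surjective H)
  let w := r - r'
  have hw : ∀ x, (FormalSum.map q w).1 x ∈ H := by
    intro x
    have hx := congrFun (congrArg Subtype.val h) x
    change Ideal.Quotient.mk H ((FormalSum.map q r).1 x) = Ideal.Quotient.mk H ((FormalSum.map q r').1 x) at hx
    rw [FormalSum.map_sub]
    exact Ideal.Quotient.eq.1 hx
  have hdiff : ∀ x : C, ∃ v : FormalSum R C, (∀ y, v.1 y ∈ H) ∧ C.act v = x - σ (q x) := by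
    intro x
    have hx : q (x - σ (q x)) = 0 := by rw [_root_.map_sub, hσ, sub_self]
    exact (QuotientAddGroup.eq_zero_iff _).1 hx
  choose v hv hv' using hdiff
  have h1 : C.act (bind w v) = C.act w - C.act (FormalSum.map (fun x => σ (q x)) w) := by
    have hs : ∀ x, C.act (v x) = C.act (single x - single (σ (q x))) := fun x => by
      rw [hv', act_sub, C.act_single, C.act_single]
    rw [act_bind]
    simp only [hs]
    rw [← act_bind, bind_sub_right, act_sub, bind_single, FormalSum.map_eq_bind]
  have h2 : C.act (bind w v) ∈ C.idealContraSpan H := C.act_bind_mem_right H w v hv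
  have h3 : C.act (FormalSum.map (fun x => σ (q x)) w) ∈ C.idealContraSpan H := by
    rw [← FormalSum.map_map q σ, FormalSum.map_eq_bind σ]
    exact C.act_bind_mem_left H _ _ hw
  have h4 : C.act w ∈ C.idealContraSpan H := by
    have := add_mem h2 h3
    rwa [h1, sub_add_cancel] at this
  have h5 : q (C.act w) = 0 := (QuotientAddGroup.eq_zero_iff _).2 h4
  rw [act_sub, _root_.map_sub] at h5
  exact sub_eq_zero.1 h5

/-- The contraaction on `C ⧸ (H ⋌ C)`: an element of `(R ⧸ H)[[C ⧸ (H ⋌ C)]]` is lifted to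
`R[[C]]`, and the contraaction of `C` is applied. -/
noncomputable def reductionAct (s : FormalSum (R ⧸ H) (C.ReductionCarrier H)) :
    C.ReductionCarrier H :=
  C.toReduction H (C.act (Function.surjInv (C.pushSum_surjective H) s))

theorem reductionAct_pushSum (r : FormalSum R C) :
    C.reductionAct H (C.pushSum H r) = C.toReduction H (C.act r) :=
  C.toReduction_act_eq H (Function.surjInv_eq (C.pushSum_surjective H) _)

theorem pushSum_bind {Y : Type*} (a : FormalSum R Y) (b : Y → FormalSum R C) :
    C.pushSum H (bind a b) = bind (coeffQuotient H a) fun y => C.pushSum H (b y) := by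
  simp only [pushSum, FormalSum.map_bind, coeffQuotient_bind]

/-- The reduction `C ⧸ (H ⋌ C)` of a left `R`-contramodule `C` modulo a strongly closed two-sided
ideal `H`, as a left `R ⧸ H`-contramodule. -/
noncomputable def reduction : LeftContramodule (R ⧸ H) where
  carrier := C.ReductionCarrier H
  act := C.reductionAct H
  act_single c := by
    obtain ⟨x, rfl⟩ := C.toReduction_surjective H c
    have h : C.pushSum H (single x) = single (C.toReduction H x) := by
      rw [pushSum, FormalSum.map_single, coeffQuotient_single]
    rw [← h, reductionAct_pushSum, C.act_single]
  act_join s := by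
    obtain ⟨t', rfl⟩ := coeffQuotient_surjective H s
    obtain ⟨t, rfl⟩ := map_surjective (C.pushSum_surjective H) t'
    have h1 : FormalSum.join (coeffQuotient H (FormalSum.map (C.pushSum H) t)) =
        C.pushSum H (FormalSum.join t) := by
      rw [coeffQuotient_map, join_map, FormalSum.join, pushSum_bind]
      rfl
    have h2 : FormalSum.map (C.reductionAct H) (coeffQuotient H (FormalSum.map (C.pushSum H) t)) =
        C.pushSum H (FormalSum.map C.act t) := by
      rw [pushSum, ← coeffQuotient_map, FormalSum.map_map, FormalSum.map_map]
      simp only [reductionAct_pushSum]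
    rw [h1, h2, reductionAct_pushSum, reductionAct_pushSum, C.act_join]

end LeftContramodule

end Ideals

end ContramoduleTheory

/-!
Reduction modulo `H` is left adjoint to restriction of scalars, which preserves epimorphisms, so it
preserves projectivity.

Conversely, a splitting of `(R ⧸ H)[[F]] → F ⧸ (H ⋌ F)` lifts to a set-theoretic section
`α : F → R[[F]]` of the contraaction which is a morphism modulo `H`. Let `T` be the substitution
`∑ r_c c ↦ ∑ r_c α(c)`. If `N` is a discrete right module, flatness allows one to prove, by
induction on the socle filtration of `N` relative to `H` (exhaustive by T-nilpotency), that `T` acts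
locally nilpotently on the kernel of the map from `N[F]`, the finite formal linear combinations, to
`N ⊙ F`: on a module killed by `H` the map `α` behaves as a morphism, so `T` annihilates this
kernel. Taking `N = R ⧸ I` for the open right ideals `I` shows that `Tⁿ` converges to zero on the
kernel of the contraaction. Hence `Tⁿ` converges on all of `R[[F]]`, and its limit factors through a
morphism `e : F → R[[F]]` that agrees with `α` modulo `H`. The composite of `e` with the
contraaction is idempotent, and it is surjective by Nakayama's lemma, so it is the identity and `F`
is a direct summand of a free contramodule.
-/

namespace ContramoduleTheory

open FormalSum MulOpposite
open Filter (Tendsto atTop cofinite)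
open scoped Topology TensorProduct

namespace LeftContramodule

open CategoryTheory

section Category

variable {R : Type u} [Ring R] [TopologicalSpace R] [IsContramoduleRing R]
variable {C D : LeftContramodule R}

instance : FunLike (Hom C D) C D where
  coe := Hom.toFun
  coe_injective _ _ := Hom.ext

instance : ConcreteCategory (LeftContramodule R) Hom where
  hom f := f
  ofHom f := f

theorem hom_act (f : Hom C D) (r : FormalSum R C) : f (C.act r) = D.act (map f r) :=
  Hom.map_act f r

instance : AddMonoidHomClass (Hom C D) C D where
  map_zero f := by
    have h : map f (0 : FormalSum R C) = 0 := by rw [map_eq_bind, bind_zero]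
    exact (hom_act f 0).trans (congrArg D.act h)
  map_add f x y := by
    have h : map f (single x + single y : FormalSum R C) = single (f x) + single (f y) := by
      rw [map_eq_bind, bind_add, single_bind, single_bind]
    exact (hom_act f (single x + single y)).trans (congrArg D.act h)

theorem act_map_sub {X : Type*} (f g : X → C) (r : FormalSum R X) :
    C.act (map (fun x => f x - g x) r) = C.act (map f r) - C.act (map g r) := by
  have h : (fun x => f x - g x) = fun x => C.act (single (f x) - single (g x)) := by
    simp only [act_sub, C.act_single]
  rw [h, ← act_bind, bind_sub_right, act_sub, ← map_eq_bind, ← map_eq_bind]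

theorem act_map_zero {X : Type*} (r : FormalSum R X) : C.act (map (fun _ => (0 : C)) r) = 0 := by
  simpa only [sub_self] using act_map_sub (fun _ => (0 : C)) (fun _ => 0) r

instance : Zero (C ⟶ D) :=
  ⟨{ toFun := fun _ => 0, map_act := fun r => (act_map_zero r).symm }⟩

/-- A subgroup of a contramodule `C` is a subcontramodule if it contains every infinite linear
combination, formed by the contraaction of `C`, of its elements. -/
def IsSubcontramodule (A : AddSubgroup C) : Prop :=
  ∀ ⦃X : Type u⦄ (f : X → C) (r : FormalSum R X), (∀ x, f x ∈ A) → C.act (map f r) ∈ A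

theorem isSubcontramodule_range (f : Hom C D) :
    IsSubcontramodule (AddMonoidHom.range (f : C →+ D)) := by
  intro X g r hg
  choose c hc using hg
  refine ⟨C.act (map c r), (hom_act f _).trans ?_⟩
  rw [map_map]
  exact congrArg (fun g => D.act (map g r)) (funext hc)

theorem IsSubcontramodule.mk_act_eq {A : AddSubgroup C} (hA : IsSubcontramodule A) {X : Type u}
    {f g : X → C} (h : ∀ x, (f x : C ⧸ A) = g x) (r : FormalSum R X) :
    (C.act (map f r) : C ⧸ A) = C.act (map g r) := by
  rw [QuotientAddGroup.eq_iff_sub_mem, ← act_map_sub]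
  exact hA _ r fun x => QuotientAddGroup.eq_iff_sub_mem.1 (h x)

/-- The quotient of a contramodule by a subcontramodule. -/
noncomputable def quotient (A : AddSubgroup C) (hA : IsSubcontramodule A) :
    LeftContramodule R where
  carrier := C ⧸ A
  act s := (C.act (map Quotient.out s) : C ⧸ A)
  act_single c := by rw [map_single, C.act_single, QuotientAddGroup.out_eq']
  act_join s := by
    rw [join, FormalSum.map_bind, act_bind, map_map]
    exact hA.mk_act_eq (fun _ => (QuotientAddGroup.out_eq' _).symm) s

/-- The projection of a contramodule onto its quotient by a subcontramodule. -/
noncomputable def quotientMk (A : AddSubgroup C) (hA : IsSubcontramodule A) :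
    C ⟶ quotient A hA where
  toFun := QuotientAddGroup.mk
  map_act r := by
    change (C.act r : C ⧸ A) = (C.act (map Quotient.out (map (QuotientAddGroup.mk (s := A)) r)))
    conv_lhs => rw [← map_id r]
    rw [map_map]
    exact hA.mk_act_eq (fun _ => (QuotientAddGroup.out_eq' _).symm) r

theorem quotientMk_eq_zero_iff {A : AddSubgroup C} (hA : IsSubcontramodule A) (c : C) :
    quotientMk A hA c = 0 ↔ c ∈ A := by
  rw [← map_zero (ConcreteCategory.hom (quotientMk A hA))]
  exact QuotientAddGroup.eq_iff_sub_mem.trans (by rw [sub_zero])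

theorem surjective_of_epi (f : C ⟶ D) [Epi f] : Function.Surjective f := by
  have hA := isSubcontramodule_range (ConcreteCategory.hom f)
  have h : quotientMk _ hA = 0 := by
    rw [← cancel_epi f]
    exact ConcreteCategory.hom_ext _ _ fun c => (quotientMk_eq_zero_iff hA _).2 ⟨c, rfl⟩
  exact fun d => (quotientMk_eq_zero_iff hA d).1 (ConcreteCategory.congr_hom h d)

end Category

section Free

variable {R : Type u} [Ring R] [TopologicalSpace R] [IsContramoduleRing R]
variable {X : Type u} {C D : LeftContramodule R}

variable (R X) in
/-- The free left contramodule `R[[X]]`, whose contraaction is the opening of parentheses. -/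
noncomputable abbrev free : LeftContramodule R where
  carrier := FormalSum R X
  act := join
  act_single _ := single_bind _ _
  act_join r := by rw [join_map, join, join, FormalSum.bind_assoc]; rfl

/-- The morphism out of a free contramodule that extends a given map on the basis. -/
noncomputable def freeLift (f : X → C) : free R X ⟶ C where
  toFun r := C.act (map f r)
  map_act r := by
    change C.act (map f (join r)) = _
    rw [join, FormalSum.map_bind, act_bind]
    rfl

theorem freeLift_single (f : X → C) (x : X) : freeLift f (single x : FormalSum R X) = f x := by
  change C.act (map f (single x)) = f x
  rw [map_single, C.act_single]

theorem free_hom_ext {f g : free R X ⟶ C}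
    (h : ∀ x : X, f (single x : FormalSum R X) = g (single x : FormalSum R X)) : f = g := by
  refine ConcreteCategory.hom_ext _ _ fun (r : FormalSum R X) => ?_
  have hr : (free R X).act (map single r) = r := (join_map r single).trans (bind_single r)
  rw [← hr, hom_act, hom_act, map_map, map_map]
  simp only [h]

instance projective_free : Projective (free R X) where
  factors {E Y} f g _ := by
    have hg := surjective_of_epi g
    refine ⟨freeLift fun x => Function.surjInv hg (f (single x : FormalSum R X)), ?_⟩
    refine free_hom_ext fun x => ?_
    rw [ConcreteCategory.comp_apply, freeLift_single, Function.surjInv_eq hg]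

theorem freeLift_surjective {f : X → C} (hf : Function.Surjective f) :
    Function.Surjective (freeLift (R := R) f) := fun c =>
  (hf c).imp' single fun x hx => (freeLift_single f x).trans hx

theorem exists_section_of_projective [Projective C] {f : X → C} (hf : Function.Surjective f) :
    ∃ e : C ⟶ free R X, ∀ c, freeLift f (e c) = c := by
  have := ConcreteCategory.epi_of_surjective _ (freeLift_surjective (R := R) hf)
  refine ⟨Projective.factorThru (𝟙 C) (freeLift f), fun c => ?_⟩
  exact ConcreteCategory.congr_hom (Projective.factorThru_comp (𝟙 C) (freeLift f)) c

theorem projective_of_section {e : C ⟶ free R X} {p : free R X ⟶ C} (h : ∀ c, p (e c) = c) :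
    Projective C :=
  Retract.projective ⟨e, p, ConcreteCategory.hom_ext _ _ h⟩

end Free

section Reduction

variable {R : Type u} [Ring R] [TopologicalSpace R] [IsContramoduleRing R]
variable {H : Ideal R} [H.IsTwoSided] [IsStronglyClosed H]

/-- The `R`-contramodule underlying an `R ⧸ H`-contramodule `D`: the set is unchanged, and `R[[D]]`
acts through `(R ⧸ H)[[D]]`. -/
noncomputable abbrev restrict (D : LeftContramodule (R ⧸ H)) : LeftContramodule R where
  carrier := D
  act r := D.act (coeffQuotient H r)
  act_single d := by rw [coeffQuotient_single, D.act_single]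
  act_join r := by
    rw [join, coeffQuotient_bind, act_bind, coeffQuotient_map]
    rfl

theorem restrict_act_map {X : Type*} {D : LeftContramodule (R ⧸ H)} (f : X → D)
    (r : FormalSum R X) : D.restrict.act (map f r) = D.act (map f (coeffQuotient H r)) :=
  congrArg D.act (coeffQuotient_map H f r)

variable (H) in
/-- Restriction of scalars from `R ⧸ H`-contramodules to `R`-contramodules. -/
noncomputable def restrictScalars : LeftContramodule (R ⧸ H) ⥤ LeftContramodule R where
  obj := restrict
  map f :=
    { toFun := f
      map_act := fun r => (hom_act f _).trans (restrict_act_map f r).symm }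

instance : (restrictScalars H).PreservesEpimorphisms where
  preserves f _ := ConcreteCategory.epi_of_surjective _ (surjective_of_epi f)

variable {C : LeftContramodule R} {D : LeftContramodule (R ⧸ H)}

theorem idealContraSpan_le_ker (f : Hom C D.restrict) :
    C.idealContraSpan H ≤ (f : C →+ D.restrict).ker := by
  rintro _ ⟨r, hr, rfl⟩
  have hr0 : coeffQuotient H r = coeffQuotient H 0 := by
    ext x
    exact (Ideal.Quotient.eq_zero_iff_mem.2 (hr x)).trans (map_zero (Ideal.Quotient.mk H)).symm
  calc f (C.act r) = f (C.act 0) := by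
        rw [hom_act, hom_act, restrict_act_map, restrict_act_map, hr0]
    _ = 0 := map_zero f

/-- The factorization through the reduction of `C` of a morphism from `C` to an
`R ⧸ H`-contramodule. -/
noncomputable def reductionDesc (f : C ⟶ D.restrict) : C.reduction H ⟶ D :=
  let g : C.ReductionCarrier H →+ D.restrict :=
    QuotientAddGroup.lift (C.idealContraSpan H)
      (AddMonoidHomClass.toAddMonoidHom (ConcreteCategory.hom f)) (idealContraSpan_le_ker f)
  { toFun := g
    map_act := fun s => by
      obtain ⟨r, rfl⟩ := C.pushSum_surjective H s
      have hg : map g (C.pushSum H r) = map f (coeffQuotient H r) := by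
        rw [pushSum, coeffQuotient_map]
        exact map_map _ _ _
      calc g (C.reductionAct H (C.pushSum H r)) = f (C.act r) :=
            congrArg g (C.reductionAct_pushSum H r)
        _ = D.act (map f (coeffQuotient H r)) := (hom_act f r).trans (restrict_act_map f r)
        _ = D.act (map g (C.pushSum H r)) := congrArg D.act hg.symm }

variable (C H) in
/-- The projection of `C` onto its reduction, as a morphism of `R`-contramodules. -/
noncomputable def reductionUnit : C ⟶ (C.reduction H).restrict where
  toFun := C.toReduction H
  map_act r := (C.reductionAct_pushSum H r).symm

variable (C D) in
/-- The adjunction between reduction modulo `H` and restriction of scalars, on morphisms. -/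
noncomputable def reductionHomEquiv :
    (C.reduction H ⟶ D) ≃ (C ⟶ (restrictScalars H).obj D) where
  toFun g := C.reductionUnit H ≫ (restrictScalars H).map g
  invFun := reductionDesc
  left_inv _ := ConcreteCategory.hom_ext _ _ fun c =>
    (C.toReduction_surjective H c).elim fun _ hx => hx ▸ rfl
  right_inv _ := rfl

variable (H) in
theorem projective_reduction [hC : Projective C] : Projective (C.reduction H) :=
  (Adjunction.adjunctionOfEquivLeft reductionHomEquiv fun _ _ _ _ _ => rfl).map_projective C hC

end Reduction

end LeftContramodule

namespace FormalSum

section Convergence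

variable {R : Type*} [Ring R] [TopologicalSpace R] [IsContramoduleRing R]
variable {X Y ι κ : Type*} {p : Filter ι}

variable (X) in
/-- The subgroup `A[[X]]` of `R[[X]]`, for a subgroup `A` of `R`. -/
def coeffsIn (A : AddSubgroup R) : AddSubgroup (FormalSum R X) where
  carrier := {r | ∀ x, r.1 x ∈ A}
  zero_mem' _ := A.zero_mem
  add_mem' hr hs x := A.add_mem (hr x) (hs x)
  neg_mem' hr x := A.neg_mem (hr x)

theorem bind_mem_coeffsIn {A : AddSubgroup R} (hA : IsClosed (A : Set R)) {r : FormalSum R Y}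
    {b : Y → FormalSum R X} (h : ∀ y x, r.1 y * (b y).1 x ∈ A) : bind r b ∈ coeffsIn X A :=
  fun x => tsum_mem_of_isClosed hA fun y => h y x

theorem bind_mem_coeffsIn_of_left {I : Submodule Rᵐᵒᵖ R} (hI : IsOpen (I : Set R))
    {r : FormalSum R Y} (hr : r ∈ coeffsIn Y I.toAddSubgroup) (b : Y → FormalSum R X) :
    bind r b ∈ coeffsIn X I.toAddSubgroup :=
  bind_mem_coeffsIn (AddSubgroup.isClosed_of_isOpen _ hI) fun y _ =>
    right_ideal_mul_mem I (hr y) _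

/-- Convergence in `R[[X]]`, uniform in the coefficients: the topology has the subgroups `I[[X]]`
for open right ideals `I` as a base of neighborhoods of zero. -/
def ConvergesTo (s : ι → FormalSum R X) (p : Filter ι) (l : FormalSum R X) : Prop :=
  ∀ I : Submodule Rᵐᵒᵖ R, IsOpen (I : Set R) →
    ∀ᶠ i in p, s i - l ∈ coeffsIn X I.toAddSubgroup

namespace ConvergesTo

variable {s t : ι → FormalSum R X} {l m : FormalSum R X}

theorem const (l : FormalSum R X) : ConvergesTo (fun _ => l) p l := fun I _ =>
  .of_forall fun _ => by rw [sub_self]; exact zero_mem _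

theorem add (hs : ConvergesTo s p l) (ht : ConvergesTo t p m) :
    ConvergesTo (fun i => s i + t i) p (l + m) := fun I hI => by
  filter_upwards [hs I hI, ht I hI] with i hi hi'
  rw [add_sub_add_comm]
  exact add_mem hi hi'

theorem comp (hs : ConvergesTo s p l) {q : Filter κ} {f : κ → ι} (hf : Tendsto f q p) :
    ConvergesTo (fun k => s (f k)) q l := fun I hI => hf.eventually (hs I hI)

theorem bind_left {s : ι → FormalSum R Y} {l : FormalSum R Y} (hs : ConvergesTo s p l)
    (b : Y → FormalSum R X) : ConvergesTo (fun i => bind (s i) b) p (bind l b) := fun I hI => by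
  filter_upwards [hs I hI] with i hi
  rw [← bind_sub]
  exact bind_mem_coeffsIn_of_left hI hi b

theorem bind_right (r : FormalSum R Y) {b : ι → Y → FormalSum R X} {c : Y → FormalSum R X}
    (hb : ∀ y, ConvergesTo (fun i => b i y) p (c y)) :
    ConvergesTo (fun i => bind r (b i)) p (bind r c) := fun I hI => by
  choose J hJ hJI using exists_mul_mem I hI
  have hfin : {y | r.1 y ∉ I}.Finite := tendsto_zero_iff.1 r.2 I hI
  filter_upwards [(Filter.eventually_all_finite hfin).2 fun y _ => hb y _ (hJ (r.1 y))] with i hi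
  rw [← bind_sub_right]
  refine bind_mem_coeffsIn (AddSubgroup.isClosed_of_isOpen _ hI) fun y x => ?_
  by_cases hy : r.1 y ∈ I
  · exact right_ideal_mul_mem I hy _
  · exact hJI _ _ (hi y hy x)

theorem tendsto_coeff (hs : ConvergesTo s p l) (x : X) :
    Tendsto (fun i => (s i).1 x) p (𝓝 (l.1 x)) := by
  rw [← tendsto_sub_nhds_zero_iff,
    (IsLinearTopology.hasBasis_open_submodule Rᵐᵒᵖ).tendsto_right_iff]
  exact fun I hI => (hs I hI).mono fun i hi => hi x

theorem unique [p.NeBot] (hl : ConvergesTo s p l) (hm : ConvergesTo s p m) : l = m :=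
  ext fun x => tendsto_nhds_unique (hl.tendsto_coeff x) (hm.tendsto_coeff x)

theorem mem_coeffsIn [p.NeBot] {A : AddSubgroup R} (hA : IsClosed (A : Set R))
    (hs : ConvergesTo s p l) (h : ∀ i, s i ∈ coeffsIn X A) : l ∈ coeffsIn X A :=
  fun x => hA.mem_of_tendsto (hs.tendsto_coeff x) (.of_forall fun i => h i x)

end ConvergesTo

theorem tsum_sub_sum_range_mem {A : AddSubgroup R} (hA : IsClosed (A : Set R)) {f : ℕ → R}
    (hf : Summable f) {n : ℕ} (h : ∀ i ≥ n, f i ∈ A) :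
    ∑' i, f i - ∑ i ∈ Finset.range n, f i ∈ A := by
  rw [← hf.sum_add_tsum_nat_add n, add_sub_cancel_left]
  exact tsum_mem_of_isClosed hA fun i => h _ (Nat.le_add_left n i)

theorem exists_convergesTo_sum {t : ℕ → FormalSum R X} (ht : ConvergesTo t atTop 0) :
    ∃ v, ConvergesTo (fun n => ∑ i ∈ Finset.range n, t i) atTop v := by
  have hsum (x : X) : Summable fun i => (t i).1 x :=
    summable_of_tendsto_zero (Nat.cofinite_eq_atTop ▸ ht.tendsto_coeff x)
  have hcoe (n : ℕ) (x : X) :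
      (∑ i ∈ Finset.range n, t i).1 x = ∑ i ∈ Finset.range n, (t i).1 x := by
    rw [AddSubgroup.val_finsetSum, Finset.sum_apply]
  have htail (I : Submodule Rᵐᵒᵖ R) (hI : IsOpen (I : Set R)) : ∀ᶠ n in atTop, ∀ x,
      ∑' i, (t i).1 x - (∑ i ∈ Finset.range n, t i).1 x ∈ I.toAddSubgroup := by
    filter_upwards [Filter.eventually_forall_ge_atTop.2 (ht I hI)] with n hn x
    rw [hcoe]
    refine tsum_sub_sum_range_mem (AddSubgroup.isClosed_of_isOpen _ hI) (hsum x) fun i hi => ?_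
    simpa only [sub_zero] using hn i hi x
  have hv : Tendsto (fun x => ∑' i, (t i).1 x) cofinite (𝓝 0) := by
    rw [tendsto_zero_iff]
    intro I hI
    obtain ⟨n, hn⟩ := (htail I hI).exists
    refine (tendsto_zero_iff.1 (∑ i ∈ Finset.range n, t i).2 I hI).subset fun x hx hx' => hx ?_
    exact (sub_add_cancel _ _ : _ = ∑' i, (t i).1 x) ▸ add_mem (hn x) hx'
  refine ⟨⟨_, hv⟩, fun I hI => (htail I hI).mono fun n hn => ?_⟩
  rw [← neg_mem_iff, neg_sub]
  exact hn

theorem bind_iterate_bindHom_single (α : X → FormalSum R X) (n : ℕ)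
    (r : FormalSum R X) : bind r (fun x => (bindHom α)^[n] (single x)) = (bindHom α)^[n] r := by
  induction n with
  | zero => exact bind_single r
  | succ n ih =>
    simp only [Function.iterate_succ_apply']
    rw [← ih]
    exact (bind_assoc r _ α).symm

theorem exists_sub_bind_eq {w : X → FormalSum R X} {a : FormalSum R X}
    (h : ConvergesTo (fun n => (bindHom w)^[n] a) atTop 0) : ∃ v, v - bind v w = a := by
  obtain ⟨v, hv⟩ := exists_convergesTo_sum h
  have hsucc (n : ℕ) : ∑ i ∈ Finset.range (n + 1), (bindHom w)^[i] a =
      bind (∑ i ∈ Finset.range n, (bindHom w)^[i] a) w + a := by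
    rw [Finset.sum_range_succ']
    simp only [Function.iterate_succ_apply']
    rw [← _root_.map_sum]
    rfl
  have hshift := hv.comp (Filter.tendsto_add_atTop_nat 1)
  simp only [hsucc] at hshift
  exact ⟨v, sub_eq_of_eq_add' (hshift.unique ((hv.bind_left w).add (.const a)))⟩

end Convergence

end FormalSum

theorem coeffQuotient_eq_iff {R : Type u} [Ring R] [TopologicalSpace R] [IsContramoduleRing R]
    {H : Ideal R} [H.IsTwoSided] [IsStronglyClosed H] {X : Type*} {r s : FormalSum R X} :
    coeffQuotient H r = coeffQuotient H s ↔ r - s ∈ coeffsIn X H.toAddSubgroup :=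
  ⟨fun h x => Ideal.Quotient.eq.1 (congrArg (fun t => t.1 x) h),
    fun h => FormalSum.ext fun x => Ideal.Quotient.eq.2 (h x)⟩

section Discrete

variable {R : Type*} [Ring R] [TopologicalSpace R] {H : Ideal R}
variable {N : Type*} [AddCommGroup N] [Module Rᵐᵒᵖ N]

/-- The orbit map `r ↦ b r` of an element `b` of a right module. -/
def orbitHom (b : N) : R →+ N where
  toFun r := op r • b
  map_zero' := by rw [op_zero, zero_smul]
  map_add' r s := by rw [op_add, add_smul]

theorem isOpen_ker_orbitHom [IsDiscreteRightModule R N] (b : N) :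
    IsOpen ((orbitHom b : R →+ N).ker : Set R) :=
  IsDiscreteRightModule.isOpen_annihilator b

theorem op_tsum_smul [IsTopologicalAddGroup R] [IsDiscreteRightModule R N] {ι : Type*} {f : ι → R}
    (hf : Summable f) (b : N) {s : Finset ι} (hs : ∀ i ∉ s, op (f i) • b = 0) :
    op (∑' i, f i) • b = ∑ i ∈ s, op (f i) • b := by
  let : TopologicalSpace N := ⊥
  have : DiscreteTopology N := ⟨rfl⟩
  have hcont : Continuous (orbitHom b : R →+ N) :=
    continuous_of_continuousAt_zero _ <| continuousAt_const.congr <|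
      ((isOpen_ker_orbitHom b).eventually_mem (zero_mem _)).mono fun _ hr => hr.symm
  exact (hf.hasSum.map (orbitHom b) hcont).unique (hasSum_sum_of_ne_finset_zero hs)

instance [IsDiscreteRightModule R N] (L : Submodule Rᵐᵒᵖ N) : IsDiscreteRightModule R L where
  isOpen_annihilator b := by
    simpa only [← Submodule.coe_smul, Submodule.coe_eq_zero] using
      IsDiscreteRightModule.isOpen_annihilator (R := R) (b : N)

instance [IsTopologicalAddGroup R] [IsDiscreteRightModule R N] (L : Submodule Rᵐᵒᵖ N) :
    IsDiscreteRightModule R (N ⧸ L) where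
  isOpen_annihilator b := by
    obtain ⟨b, rfl⟩ := L.mkQ_surjective b
    have hle : (orbitHom b : R →+ N).ker ≤ (orbitHom (L.mkQ b)).ker := fun r hr =>
      (map_smul L.mkQ (op r) b).symm.trans ((congrArg L.mkQ hr).trans (map_zero _))
    exact AddSubgroup.isOpen_mono hle (isOpen_ker_orbitHom b)

theorem isDiscreteRightModule_quotient [IsTopologicalRing R] {I : Submodule Rᵐᵒᵖ R}
    (hI : IsOpen (I : Set R)) : IsDiscreteRightModule R (R ⧸ I) where
  isOpen_annihilator b := by
    obtain ⟨b, rfl⟩ := I.mkQ_surjective b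
    have h : {r : R | op r • I.mkQ b = 0} = (fun r => b * r) ⁻¹' (I : Set R) := by
      ext r
      rw [Set.mem_ofPred_eq, ← map_smul, Submodule.mkQ_apply, Submodule.Quotient.mk_eq_zero]
      rfl
    rw [h]
    exact hI.preimage (continuous_const_mul b)

theorem IsTopologicallyLeftTNilpotent.induction_on [IsDiscreteRightModule R N]
    (hH : IsTopologicallyLeftTNilpotent H) {P : N → Prop} (b : N) (zero : P 0)
    (step : ∀ b, (∀ h ∈ H, P (op h • b)) → P b) : P b := by
  by_contra hb
  have hnext (b : {b // ¬P b}) : ∃ h ∈ H, ¬P (op h • b.1) := by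
    by_contra! hcon
    exact b.2 (step _ hcon)
  choose g hgH hg using hnext
  let seq (n : ℕ) : {b // ¬P b} := (fun b => ⟨op (g b) • b.1, hg b⟩)^[n] ⟨b, hb⟩
  have hseq (n : ℕ) : (seq n).1 = op ((List.range n).map fun i => g (seq i)).prod • b := by
    induction n with
    | zero => simp [seq]
    | succ n ih =>
      simp only [List.range_succ, List.map_append, List.prod_append, List.map_singleton,
        List.prod_singleton, op_mul, mul_smul, ← ih]
      exact congrArg Subtype.val (Function.iterate_succ_apply' _ n _)
  obtain ⟨n, hn⟩ := ((hH _ fun i => hgH (seq i)).eventually_mem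
    ((isOpen_ker_orbitHom b).mem_nhds (zero_mem _))).exists
  exact (seq (n + 1)).2 (((hseq _).trans hn) ▸ zero)

variable (H N) in
/-- The submodule of the elements of a right module killed by a left ideal `H`. -/
def annihilatedBy : Submodule Rᵐᵒᵖ N where
  carrier := {b | ∀ h ∈ H, op h • b = 0}
  zero_mem' _ _ := smul_zero _
  add_mem' ha hb h hh := by rw [smul_add, ha h hh, hb h hh, add_zero]
  smul_mem' c b hb h hh := by
    rw [← mul_smul]
    exact hb _ (H.mul_mem_left c.unop hh)

/-- Transfinite induction along the filtration of a discrete module whose successive quotients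
consist of the elements killed by `H` (the socle filtration relative to `H`); the filtration is
exhaustive by T-nilpotency. -/
theorem IsTopologicallyLeftTNilpotent.submodule_induction [IsDiscreteRightModule R N]
    (hH : IsTopologicallyLeftTNilpotent H) {P : Submodule Rᵐᵒᵖ N → Prop} (bot : P ⊥)
    (directed : ∀ c : Set (Submodule Rᵐᵒᵖ N), c.Nonempty → DirectedOn (· ≤ ·) c →
      (∀ L ∈ c, P L) → P (sSup c))
    (step : ∀ L, P L → P ((annihilatedBy H (N ⧸ L)).comap L.mkQ)) : P ⊤ := by
  obtain ⟨L, -, hPL, hmax⟩ := zorn_le_nonempty₀ {L | P L}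
    (fun c hcP hc L hL => ⟨_, directed c ⟨L, hL⟩ hc.directedOn hcP, fun _ => le_sSup⟩) ⊥ bot
  have hle : L ≤ (annihilatedBy H (N ⧸ L)).comap L.mkQ := fun b hb => by
    rw [Submodule.mem_comap, Submodule.mkQ_apply, (Submodule.Quotient.mk_eq_zero L).2 hb]
    exact zero_mem _
  have htop : L = ⊤ := Submodule.eq_top_iff'.2 fun b =>
    hH.induction_on b L.zero_mem fun b hb => hmax (step L hPL) hle fun h hh => by
      rw [← map_smul]
      exact (Submodule.Quotient.mk_eq_zero L).2 (hb h hh)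
  exact htop ▸ hPL

end Discrete

/-- The subgroup of the elements annihilated by some iterate of an additive endomorphism. -/
def locallyNilpotentPart {A : Type*} [AddCommGroup A] (T : A →+ A) : AddSubgroup A where
  carrier := {a | ∀ᶠ n in atTop, T^[n] a = 0}
  zero_mem' := .of_forall fun n => iterate_map_zero T n
  add_mem' ha hb := by
    filter_upwards [ha, hb] with n hna hnb
    rw [iterate_map_add, hna, hnb, add_zero]
  neg_mem' ha := by
    filter_upwards [ha] with n hna
    rw [iterate_map_neg, hna, neg_zero]

theorem mem_locallyNilpotentPart_of_apply {A : Type*} [AddCommGroup A] {T : A →+ A} {a : A}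
    (h : T a ∈ locallyNilpotentPart T) : a ∈ locallyNilpotentPart T := by
  change ∀ᶠ n in atTop, T^[n] a = 0
  rwa [← Filter.map_add_atTop_eq_nat 1]

section Finsupp

variable {R : Type*} [Ring R] [TopologicalSpace R] [IsContramoduleRing R] {H : Ideal R}
variable {N : Type*} [AddCommGroup N] [Module Rᵐᵒᵖ N] [IsDiscreteRightModule R N]
variable {M : Type*} [AddCommGroup M] [Module Rᵐᵒᵖ M] [IsDiscreteRightModule R M]
variable {X Y : Type*}

/-- The pairing `N × R[[X]] → N[X]`, `(b, ∑ rₓ x) ↦ ∑ (b rₓ) x`, where `N[X]` is the group of finite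
formal linear combinations of elements of `X` with coefficients in the discrete module `N`. -/
noncomputable def smulFinsupp : N →+ FormalSum R X →+ (X →₀ N) :=
  AddMonoidHom.mk' (fun b => AddMonoidHom.mk'
    (fun r => Finsupp.ofSupportFinite (fun x => op (r.1 x) • b) (finite_support_smul b r))
    fun r s => Finsupp.ext fun x => add_smul (op (r.1 x)) (op (s.1 x)) b)
    fun b b' => AddMonoidHom.ext fun r => Finsupp.ext fun x => smul_add (op (r.1 x)) b b'

theorem smulFinsupp_apply (b : N) (r : FormalSum R X) (x : X) :
    smulFinsupp b r x = op (r.1 x) • b := rfl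

theorem smulFinsupp_single (b : N) (x : X) :
    smulFinsupp b (single x : FormalSum R X) = Finsupp.single x b := by
  classical
  ext y
  rw [smulFinsupp_apply, Finsupp.single_apply]
  by_cases h : x = y <;> simp [single, h, Ne.symm]

/-- The substitution of `α y ∈ R[[X]]` for every formal variable `y` in a finite formal linear
combination with coefficients in a discrete module. -/
noncomputable def bindFinsupp (α : Y → FormalSum R X) : (Y →₀ N) →+ (X →₀ N) :=
  Finsupp.liftAddHom fun y => smulFinsupp.flip (α y)

theorem bindFinsupp_single (α : Y → FormalSum R X) (y : Y) (b : N) :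
    bindFinsupp α (Finsupp.single y b) = smulFinsupp b (α y) :=
  Finsupp.liftAddHom_apply_single _ y b

theorem bindFinsupp_smulFinsupp (α : Y → FormalSum R X) (b : N) (r : FormalSum R Y) :
    bindFinsupp α (smulFinsupp b r) = smulFinsupp b (bind r α) := by
  ext x
  have hs (y : Y) (hy : y ∉ (smulFinsupp b r).support) : op (r.1 y * (α y).1 x) • b = 0 := by
    rw [op_mul, mul_smul, ← smulFinsupp_apply b r, Finsupp.notMem_support_iff.1 hy, smul_zero]
  rw [bindFinsupp, Finsupp.liftAddHom_apply, Finsupp.sum, Finsupp.finsetSum_apply]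
  refine Eq.trans ?_ (op_tsum_smul (summable_bind r _) b hs).symm
  simp only [op_mul, mul_smul]
  rfl

theorem bindFinsupp_iterate_smulFinsupp (α : X → FormalSum R X) (b : N) (r : FormalSum R X)
    (n : ℕ) : (bindFinsupp α)^[n] (smulFinsupp b r) = smulFinsupp b ((bindHom α)^[n] r) :=
  ((show Function.Semiconj (smulFinsupp b) (bindHom α) (bindFinsupp α) from
    fun r => (bindFinsupp_smulFinsupp α b r).symm).iterate_right n r).symm

theorem mapRange_bindFinsupp (f : N →ₗ[Rᵐᵒᵖ] M) (α : Y → FormalSum R X) (z : Y →₀ N) :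
    Finsupp.mapRange.addMonoidHom f.toAddMonoidHom (bindFinsupp α z) =
      bindFinsupp α (Finsupp.mapRange.addMonoidHom f.toAddMonoidHom z) := by
  induction z using Finsupp.induction_linear with
  | zero => simp only [map_zero]
  | add z z' hz hz' => simp only [map_add, hz, hz']
  | single y b =>
    ext x
    simp only [Finsupp.mapRange.addMonoidHom_apply, Finsupp.mapRange_single, bindFinsupp_single,
      Finsupp.mapRange_apply, smulFinsupp_apply]
    exact map_smul f _ b

theorem locallyNilpotentPart_bindFinsupp_eq_top (hH : IsTopologicallyLeftTNilpotent H)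
    {w : X → FormalSum R X} (hw : ∀ x, w x ∈ coeffsIn X H.toAddSubgroup) :
    locallyNilpotentPart (bindFinsupp w : (X →₀ N) →+ (X →₀ N)) = ⊤ := by
  have hsingle (b : N) : ∀ x, Finsupp.single x b ∈ locallyNilpotentPart (bindFinsupp w) := by
    refine hH.induction_on (P := fun b => ∀ x, Finsupp.single x b ∈ locallyNilpotentPart _) b
      (fun x => ?_) fun b ih x => mem_locallyNilpotentPart_of_apply ?_
    · rw [Finsupp.single_zero]
      exact zero_mem _
    · rw [bindFinsupp_single, ← Finsupp.sum_single (smulFinsupp b (w x))]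
      exact sum_mem fun y _ => ih _ (hw x y) y
  refine (AddSubgroup.eq_top_iff' _).2 fun z => ?_
  rw [← Finsupp.sum_single z]
  exact sum_mem fun x _ => hsingle (z x) x

theorem convergesTo_iterate_zero_of_mem_locallyNilpotentPart
    {α : X → FormalSum R X} {r : FormalSum R X}
    (h : ∀ (I : Submodule Rᵐᵒᵖ R) [IsDiscreteRightModule R (R ⧸ I)],
      smulFinsupp (I.mkQ 1) r ∈ locallyNilpotentPart (bindFinsupp α)) :
    ConvergesTo (fun n => (bindHom α)^[n] r) atTop 0 := fun I hI => by
  have := isDiscreteRightModule_quotient hI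
  filter_upwards [h I] with n hn x
  have hx : I.mkQ (((bindHom α)^[n] r).1 x) = 0 := by
    have := DFunLike.congr_fun hn x
    rw [bindFinsupp_iterate_smulFinsupp, smulFinsupp_apply, ← map_smul, op_smul_eq_mul, one_mul]
      at this
    exact this
  rw [sub_zero]
  exact (Submodule.Quotient.mk_eq_zero I).1 hx

end Finsupp

namespace LeftContramodule

variable {R : Type u} [Ring R] [TopologicalSpace R] [IsContramoduleRing R] {H : Ideal R}
variable {C D : LeftContramodule R}

/-- Nakayama's lemma: the preimage of `d` is read off the geometric series `∑ Tⁿ d`, where `T`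
is the substitution of `w d` for every formal variable `d`. -/
theorem surjective_of_forall_exists_sub_mem (hH : IsTopologicallyLeftTNilpotent H) (f : Hom C D)
    (h : ∀ d, ∃ c, d - f c ∈ D.contraSpan H.toAddSubgroup) : Function.Surjective f := fun d => by
  choose c w hw hact using h
  have hlim : ConvergesTo (fun n => (bindHom w)^[n] (single d)) atTop 0 :=
    convergesTo_iterate_zero_of_mem_locallyNilpotentPart fun I _ => by
      rw [locallyNilpotentPart_bindFinsupp_eq_top hH hw]
      trivial
  obtain ⟨v, hv⟩ := exists_sub_bind_eq hlim
  refine ⟨C.act (map c v), ?_⟩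
  calc f (C.act (map c v)) = D.act (map (fun d => f (c d)) v) := by rw [hom_act, map_map]
    _ = D.act (map (fun d => D.act (single d - w d)) v) := by
      simp only [act_sub, D.act_single, hact, sub_sub_cancel]
    _ = D.act (v - bind v w) := by rw [← act_bind, bind_sub_right, bind_single]
    _ = d := by rw [hv, D.act_single]

end LeftContramodule

theorem exists_forall_mem_of_forall_mem_sSup {S M X : Type*} [Semiring S] [AddCommMonoid M]
    [Module S M] {s : Set (Submodule S M)} (hs : s.Nonempty) (hdir : DirectedOn (· ≤ ·) s)
    {z : X →₀ M} (hz : ∀ x, z x ∈ sSup s) : ∃ L ∈ s, ∀ x, z x ∈ L := by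
  have hcover : z '' z.support ⊆ ⋃₀ (SetLike.coe '' s) := by
    rintro _ ⟨x, -, rfl⟩
    obtain ⟨L, hL, hx⟩ := (Submodule.mem_sSup_of_directed hs hdir).1 (hz x)
    exact ⟨L, ⟨L, hL, rfl⟩, hx⟩
  have hdir' : DirectedOn (· ⊆ ·) (SetLike.coe '' s : Set (Set M)) := directedOn_image.2 hdir
  obtain ⟨_, ⟨L, hL, rfl⟩, hLz⟩ := hdir'.exists_mem_subset_of_finite_of_subset_sUnion
    (hs.image _) (z.support.finite_toSet.image z) hcover
  refine ⟨L, hL, fun x => ?_⟩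
  by_cases hx : x ∈ z.support
  · exact hLz ⟨x, hx, rfl⟩
  · exact Finsupp.notMem_support_iff.1 hx ▸ L.zero_mem

section Contratensor

variable {R : Type u} [Ring R] [TopologicalSpace R] [IsContramoduleRing R]
variable {N : Type u} [AddCommGroup N] {C : LeftContramodule R}

variable (N C) in
/-- The map `N[C] → N ⊗ C` from the finite formal linear combinations of elements of `C`
to the tensor product, `∑ b_c c ↦ ∑ b_c ⊗ c`. -/
noncomputable def toTensor : (C →₀ N) →+ N ⊗[ℤ] C :=
  Finsupp.liftAddHom fun c => ((TensorProduct.mk ℤ N C).flip c).toAddMonoidHom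

theorem toTensor_single (c : C) (b : N) : toTensor N C (Finsupp.single c b) = b ⊗ₜ c :=
  Finsupp.liftAddHom_apply_single _ c b

variable [Module Rᵐᵒᵖ N] {M : Type u} [AddCommGroup M] [Module Rᵐᵒᵖ M]

theorem toTensor_smulFinsupp [IsDiscreteRightModule R N] (b : N) (r : FormalSum R C) :
    toTensor N C (smulFinsupp b r) = ∑ᶠ c : C, (op (r.1 c) • b) ⊗ₜ[ℤ] c := by
  rw [toTensor, Finsupp.liftAddHom_apply, Finsupp.sum,
    finsum_eq_sum_of_support_subset (s := (smulFinsupp b r).support)]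
  · rfl
  · refine Function.support_subset_iff'.2 fun c hc => ?_
    rw [← smulFinsupp_apply, Finsupp.notMem_support_iff.1 hc, TensorProduct.zero_tmul]

variable (N C) in
/-- The map `N[C] → N ⊙ C` to the contratensor product. -/
noncomputable def toContratensor : (C →₀ N) →+ Contratensor N C :=
  (QuotientAddGroup.mk' _).comp (toTensor N C)

theorem toContratensor_smulFinsupp [IsDiscreteRightModule R N] (b : N) (r : FormalSum R C) :
    toContratensor N C (smulFinsupp b r) = toContratensor N C (Finsupp.single (C.act r) b) := by
  refine Eq.symm (sub_eq_zero.1 ?_)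
  rw [← _root_.map_sub]
  refine (QuotientAddGroup.eq_zero_iff _).2 (AddSubgroup.subset_closure ⟨(b, r), ?_⟩)
  rw [_root_.map_sub, toTensor_single, toTensor_smulFinsupp]

theorem ker_toContratensor_le [IsDiscreteRightModule R N] {A : Type*} [AddCommGroup A]
    {Φ : (C →₀ N) →+ A}
    (hΦ : ∀ b r, Φ (smulFinsupp b r) = Φ (Finsupp.single (C.act r) b)) :
    (toContratensor N C).ker ≤ Φ.ker := fun z hz => by
  have hadd (b : N) (c d : C) :
      Φ (Finsupp.single (c + d) b) = Φ (Finsupp.single c b) + Φ (Finsupp.single d b) :=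
    calc Φ (Finsupp.single (c + d) b)
      _ = Φ (smulFinsupp b (single c + single d)) := (hΦ b (single c + single d)).symm
      _ = _ := by rw [map_add, map_add, smulFinsupp_single, smulFinsupp_single]
  let β : N ⊗[ℤ] C →+ A := TensorProduct.liftAddHom
    (AddMonoidHom.mk' (fun b => AddMonoidHom.mk' (fun c => Φ (Finsupp.single c b)) (hadd b))
      fun b b' => AddMonoidHom.ext fun c => by
        simp only [AddMonoidHom.mk'_apply, AddMonoidHom.add_apply, Finsupp.single_add, map_add])
    fun n b c => by simp only [map_zsmul, AddMonoidHom.coe_smul, Pi.smul_apply]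
  have hβ (z : C →₀ N) : β (toTensor N C z) = Φ z := by
    have h : β.comp (toTensor N C) = Φ := Finsupp.addHom_ext fun c b => by
      rw [AddMonoidHom.comp_apply, toTensor_single]
      rfl
    exact DFunLike.congr_fun h z
  have hrel : contratensorRelations N C ≤ β.ker := by
    rw [contratensorRelations, AddSubgroup.closure_le]
    rintro _ ⟨⟨b, r⟩, rfl⟩
    change β _ = 0
    rw [_root_.map_sub, ← toTensor_smulFinsupp, hβ, hΦ, sub_eq_zero]
    rfl
  exact (hβ z).symm.trans (hrel ((QuotientAddGroup.eq_zero_iff _).1 hz))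

theorem toContratensor_bindFinsupp [IsDiscreteRightModule R N] {α : C → FormalSum R C}
    (hα : ∀ c, C.act (α c) = c) (z : C →₀ N) :
    toContratensor N C (bindFinsupp α z) = toContratensor N C z := by
  have h : (toContratensor N C).comp (bindFinsupp α) = toContratensor N C :=
    Finsupp.addHom_ext fun c b => by
      rw [AddMonoidHom.comp_apply, bindFinsupp_single, toContratensor_smulFinsupp, hα]
  exact DFunLike.congr_fun h z

theorem contratensorMap_toContratensor [IsDiscreteRightModule R N] (f : N →ₗ[Rᵐᵒᵖ] M)
    (z : C →₀ N) : contratensorMap C f (toContratensor N C z) =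
      toContratensor M C (Finsupp.mapRange.addMonoidHom f.toAddMonoidHom z) := by
  have h : (contratensorMap C f).comp (toContratensor N C) =
      (toContratensor M C).comp (Finsupp.mapRange.addMonoidHom f.toAddMonoidHom) :=
    Finsupp.addHom_ext fun c b => by
      simp only [AddMonoidHom.comp_apply, toContratensor, Finsupp.mapRange.addMonoidHom_apply,
        Finsupp.mapRange_single, toTensor_single]
      rfl
  exact DFunLike.congr_fun h z

end Contratensor

namespace LeftContramodule

open CategoryTheory

variable {R : Type u} [Ring R] [TopologicalSpace R] [IsContramoduleRing R] {H : Ideal R}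
variable {C : LeftContramodule R}
variable {N : Type u} [AddCommGroup N] [Module Rᵐᵒᵖ N] [IsDiscreteRightModule R N]

/-- A section `α` of the contraaction `R[[C]] → C` which is a morphism of contramodules modulo
`H`. -/
structure IsSplittingModulo (H : Ideal R) (α : C → FormalSum R C) : Prop where
  act : ∀ c, C.act (α c) = c
  sub_mem : ∀ r, α (C.act r) - bind r α ∈ coeffsIn C H.toAddSubgroup

variable {α : C → FormalSum R C}

theorem bindFinsupp_eq_zero_of_annihilatedBy_eq_top (hN : annihilatedBy H N = ⊤)
    (hα : ∀ r, α (C.act r) - bind r α ∈ coeffsIn C H.toAddSubgroup) {z : C →₀ N}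
    (hz : toContratensor N C z = 0) : bindFinsupp α z = 0 := by
  refine ker_toContratensor_le (fun b r => ?_) hz
  rw [bindFinsupp_smulFinsupp, bindFinsupp_single, ← sub_eq_zero, ← _root_.map_sub, ← neg_sub,
    map_neg, neg_eq_zero]
  exact Finsupp.ext fun c => hN.ge trivial _ (hα r c)

theorem IsFlat.bindFinsupp_eq_zero (hC : C.IsFlat)
    (hα : ∀ r, α (C.act r) - bind r α ∈ coeffsIn C H.toAddSubgroup) {z : C →₀ N}
    (hzH : ∀ c, z c ∈ annihilatedBy H N) (hz : toContratensor N C z = 0) :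
    bindFinsupp α z = 0 := by
  let K := annihilatedBy H N
  let z' : C →₀ K := Finsupp.ofSupportFinite (fun c => ⟨z c, hzH c⟩)
    (z.hasFiniteSupport.subset fun c hc h => hc (Subtype.ext h))
  have hmap : Finsupp.mapRange.addMonoidHom K.subtype.toAddMonoidHom z' = z :=
    Finsupp.ext fun c => rfl
  have hinj := (hC K N (N ⧸ K) K.subtype K.mkQ K.injective_subtype
    (LinearMap.exact_subtype_mkQ K) K.mkQ_surjective).1
  have hz' : toContratensor K C z' = 0 := hinj <| by
    rw [contratensorMap_toContratensor, hmap, hz, map_zero]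
  have hK : annihilatedBy H K = ⊤ :=
    Submodule.eq_top_iff'.2 fun b h hh => Subtype.ext (b.2 h hh)
  rw [← hmap, ← mapRange_bindFinsupp, bindFinsupp_eq_zero_of_annihilatedBy_eq_top hK hα hz',
    map_zero]

/-- By induction along the socle filtration: each application of `bindFinsupp α` moves the
coefficients down by one step. -/
theorem IsFlat.ker_toContratensor_le_locallyNilpotentPart (hC : C.IsFlat)
    (hH : IsTopologicallyLeftTNilpotent H) (hα : IsSplittingModulo H α) :
    (toContratensor N C).ker ≤ locallyNilpotentPart (bindFinsupp α) := by
  have htop := hH.submodule_induction (N := N) (P := fun L => ∀ z : C →₀ N, (∀ c, z c ∈ L) →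
    toContratensor N C z = 0 → z ∈ locallyNilpotentPart (bindFinsupp α)) ?bot ?directed ?step
  · exact fun z hz => htop z (fun _ => trivial) hz
  case bot =>
    intro z hz _
    rw [show z = 0 from Finsupp.ext hz]
    exact zero_mem _
  case directed =>
    intro s hs hdir ih z hz hz0
    obtain ⟨L, hL, hLz⟩ := exists_forall_mem_of_forall_mem_sSup hs hdir hz
    exact ih L hL z hLz hz0
  case step =>
    intro L ih z hz hz0
    have hzero : bindFinsupp α (Finsupp.mapRange.addMonoidHom L.mkQ.toAddMonoidHom z) = 0 :=
      hC.bindFinsupp_eq_zero hα.sub_mem hz <| by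
        rw [← contratensorMap_toContratensor, hz0, map_zero]
    rw [← mapRange_bindFinsupp] at hzero
    refine mem_locallyNilpotentPart_of_apply (ih _ (fun c => ?_) ?_)
    · exact (Submodule.Quotient.mk_eq_zero L).1 (DFunLike.congr_fun hzero c)
    · rw [toContratensor_bindFinsupp hα.act, hz0]

theorem IsFlat.convergesTo_iterate_zero (hC : C.IsFlat) (hH : IsTopologicallyLeftTNilpotent H)
    (hα : IsSplittingModulo H α) {k : FormalSum R C} (hk : C.act k = 0) :
    ConvergesTo (fun n => (bindHom α)^[n] k) atTop 0 := by
  refine convergesTo_iterate_zero_of_mem_locallyNilpotentPart fun I _ =>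
    hC.ker_toContratensor_le_locallyNilpotentPart hH hα ?_
  rw [AddMonoidHom.mem_ker, toContratensor_smulFinsupp, hk, toContratensor,
    AddMonoidHom.comp_apply, toTensor_single, TensorProduct.tmul_zero, map_zero]

section Splitting

variable [H.IsTwoSided] [IsStronglyClosed H]

theorem exists_act_eq_and_coeffQuotient_eq {x : C} {s : FormalSum (R ⧸ H) C}
    (hs : C.reductionAct H (map (C.toReduction H) s) = C.toReduction H x) :
    ∃ a : FormalSum R C, C.act a = x ∧ coeffQuotient H a = s := by
  obtain ⟨r, rfl⟩ := coeffQuotient_surjective H s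
  have hr : C.toReduction H (C.act r) = C.toReduction H x := by
    rw [← hs, ← coeffQuotient_map]
    exact (C.reductionAct_pushSum H r).symm
  obtain ⟨w, hw, hwx⟩ := QuotientAddGroup.eq_iff_sub_mem.1 hr.symm
  refine ⟨w + r, ?_, coeffQuotient_eq_iff.2 ?_⟩
  · rw [act_add, hwx, sub_add_cancel]
  · rw [add_sub_cancel_right]
    exact hw

variable (H C) in
theorem exists_isSplittingModulo [Projective (C.reduction H)] :
    ∃ α : C → FormalSum R C, C.IsSplittingModulo H α := by
  let q : C → C.reduction H := C.toReduction H
  obtain ⟨e, he⟩ := exists_section_of_projective (f := q) (C.toReduction_surjective H)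
  choose α hact hα using fun x => exists_act_eq_and_coeffQuotient_eq (he (q x))
  refine ⟨α, hact, fun r => coeffQuotient_eq_iff.1 ?_⟩
  calc coeffQuotient H (α (C.act r))
    _ = e ((C.reduction H).act (C.pushSum H r)) := by
      rw [hα]
      exact congrArg e (C.reductionAct_pushSum H r).symm
    _ = bind (coeffQuotient H (map q r)) e := (hom_act e _).trans (join_map _ _)
    _ = bind (coeffQuotient H r) (fun x => e (q x)) := by rw [coeffQuotient_map, FormalSum.bind_map]
    _ = coeffQuotient H (bind r α) := by simp only [coeffQuotient_bind, hα]

end Splitting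

theorem act_iterate_bindHom (hα : ∀ c, C.act (α c) = c) (n : ℕ) (r : FormalSum R C) :
    C.act ((bindHom α)^[n] r) = C.act r := by
  induction n with
  | zero => rfl
  | succ n ih =>
    rw [Function.iterate_succ_apply', ← ih]
    exact (act_bind _ _).trans (by simp only [hα, FormalSum.map_id])

theorem IsFlat.exists_convergesTo_iterate_single (hC : C.IsFlat)
    (hH : IsTopologicallyLeftTNilpotent H) (hα : C.IsSplittingModulo H α) (c : C) :
    ∃ l, ConvergesTo (fun n => (bindHom α)^[n] (single c)) atTop l := by
  have hker : C.act (α c - single c) = 0 := by rw [act_sub, hα.act, C.act_single, sub_self]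
  obtain ⟨v, hv⟩ := exists_convergesTo_sum (hC.convergesTo_iterate_zero hH hα hker)
  have hsum (n : ℕ) : single c + ∑ i ∈ Finset.range n, (bindHom α)^[i] (α c - single c) =
      (bindHom α)^[n] (single c) := by
    have hstep (i : ℕ) : (bindHom α)^[i] (α c - single c) =
        (bindHom α)^[i + 1] (single c) - (bindHom α)^[i] (single c) := by
      rw [iterate_map_sub, Function.iterate_succ_apply]
      exact congrArg (fun t => (bindHom α)^[i] t - _) (single_bind c α).symm
    simp only [hstep, Finset.sum_range_sub (fun i => (bindHom α)^[i] (single c)),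
      Function.iterate_zero_apply, add_sub_cancel]
  exact ⟨single c + v, by simpa only [hsum] using (ConvergesTo.const (single c)).add hv⟩

theorem IsFlat.exists_hom_convergesTo_iterate (hC : C.IsFlat)
    (hH : IsTopologicallyLeftTNilpotent H) (hα : C.IsSplittingModulo H α) :
    ∃ e : C ⟶ free R C, ∀ r, ConvergesTo (fun n => (bindHom α)^[n] r) atTop (e (C.act r)) := by
  choose e he using hC.exists_convergesTo_iterate_single hH hα
  have hbind (r : FormalSum R C) : ConvergesTo (fun n => (bindHom α)^[n] r) atTop (bind r e) := by
    simpa only [bind_iterate_bindHom_single] using ConvergesTo.bind_right r he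
  have hact (r : FormalSum R C) :
      ConvergesTo (fun n => (bindHom α)^[n] r) atTop (e (C.act r)) := by
    have hker : C.act (r - single (C.act r)) = 0 := by rw [act_sub, C.act_single, sub_self]
    have h := (hC.convergesTo_iterate_zero hH hα hker).add (he (C.act r))
    simpa only [iterate_map_sub, sub_add_cancel, zero_add] using h
  refine ⟨{ toFun := e, map_act := fun r => ?_ }, hact⟩
  exact ((hact r).unique (hbind r)).trans (join_map r e).symm

theorem IsSplittingModulo.iterate_single_sub_mem (hα : C.IsSplittingModulo H α) (n : ℕ) (c : C) :
    (bindHom α)^[n + 1] (single c) - α c ∈ coeffsIn C H.toAddSubgroup := by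
  have h := hα.sub_mem ((bindHom α)^[n] (single c))
  rw [act_iterate_bindHom hα.act, C.act_single] at h
  rw [Function.iterate_succ_apply', ← neg_sub]
  exact neg_mem h

theorem IsFlat.projective_of_isSplittingModulo (hC : C.IsFlat) (hclosed : IsClosed (H : Set R))
    (hH : IsTopologicallyLeftTNilpotent H) (hα : C.IsSplittingModulo H α) : Projective C := by
  obtain ⟨e, he⟩ := hC.exists_hom_convergesTo_iterate hH hα
  have hlim (c : C) : ConvergesTo (fun n => (bindHom α)^[n] (single c)) atTop (e c) := by
    simpa only [C.act_single] using he (single c)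
  have hsucc (c : C) : ConvergesTo (fun n => (bindHom α)^[n + 1] (single c)) atTop (e c) :=
    (hlim c).comp (Filter.tendsto_add_atTop_nat 1)
  have hfix (c : C) : bindHom α (e c) = e c := by
    simp only [Function.iterate_succ_apply'] at hsucc
    exact ((hlim c).bind_left α).unique (hsucc c)
  have hidem (c : C) : e (C.act (e c)) = e c := by
    refine (he (e c)).unique ?_
    simp only [Function.iterate_fixed (hfix c)]
    exact .const _
  have hmod (c : C) : e c - α c ∈ coeffsIn C H.toAddSubgroup := by
    rw [sub_eq_add_neg]
    exact ((hsucc c).add (.const (-α c))).mem_coeffsIn hclosed fun n =>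
      sub_eq_add_neg _ (α c) ▸ hα.iterate_single_sub_mem n c
  have hp (r : FormalSum R C) : freeLift id r = C.act r := congrArg C.act (map_id r)
  have hsurj : Function.Surjective (e ≫ freeLift id) := by
    refine surjective_of_forall_exists_sub_mem hH _ fun c => ⟨c, α c - e c, ?_, ?_⟩
    · rw [← neg_sub]
      exact neg_mem (hmod c)
    · rw [act_sub, hα.act]
      exact congrArg (c - ·) (hp (e c)).symm
  refine projective_of_section (e := e) (p := freeLift id) fun c => ?_
  obtain ⟨c, rfl⟩ := hsurj c
  rw [ConcreteCategory.comp_apply, hp (e c), hidem, hp]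

end LeftContramodule

end ContramoduleTheory

theorem theorem8p3 {R : Type u} [Ring R] [TopologicalSpace R]
    [ContramoduleTheory.IsContramoduleRing R]
    (H : Ideal R) [H.IsTwoSided] [ContramoduleTheory.IsStronglyClosed H]
    (hH : ContramoduleTheory.IsTopologicallyLeftTNilpotent H)
    (F : ContramoduleTheory.LeftContramodule R) (hF : F.IsFlat) :
    CategoryTheory.Projective F ↔ CategoryTheory.Projective (F.reduction H) := by
  refine ⟨fun _ => ContramoduleTheory.LeftContramodule.projective_reduction H, fun _ => ?_⟩
  obtain ⟨α, hα⟩ := F.exists_isSplittingModulo H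
  exact hF.projective_of_isSplittingModulo
    (ContramoduleTheory.IsStronglyClosed.isClosed (H := H)) hH hα
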